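/- Let $K$ be a field and $R=K[x_1,\ldots,x_n]$ with its standard $\mathbb Z^n$-grading. For a $\mathbb Z^n$-graded $R$-module $M$ let $K_\bullet(M)=\bigwedge^\bullet R^n\otimes_R M$ be the Koszul complex of $M$ with respect to $x_1,\ldots,x_n$, where $R^n$ has basis $e_1,\ldots,e_n$, $\partial(e_j)=x_j$, and $e_j$ has the multidegree of $x_j$; let $H_i(M)$ be its $i$-th homology. For $b\in\mathbb Z^n$, $M(-b)$ denotes the shifted module with $M(-b)_a=M_{a-b}$. For a monomial ideal $J$ let $G(J)$ be its unique minimal set of monomial generators. Let $J\subset R$ be a monomial ideal, $f\in R\setminus J$ a monomial of multidegree $b$, and $I=(J,f)$. Suppose that there is an index $t$ such that $x_t$ divides $f$ but $x_t$ divides no $g\in G(J)$. Then for all $i>0$ there is a short exact sequence with homogeneous maps of degree $0$ $$0\longrightarrow H_i(R/J)\longrightarrow H_i(R/I)\overset{\delta}{\longrightarrow} H_{i-1}\bigl(R/(J:I)(-b)\bigr)\longrightarrow 0,$$ where the first map is induced by the canonical projection $R/J\to R/I$ and $\delta$ is the connecting homomorphism of the exact sequence $0\to R/(J:I)(-b)\overset{f}{\to}R/J\to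 R/I\to 0$. Moreover, for each cycle $z\in K_{i-1}(R/(J:I)(-b))$ the element $(-1)^{i-1}z\wedge (f/x_t)e_t$ is a well-defined cycle of $K_i(R/I)$, and its class $[(-1)^{i-1}z\wedge (f/x_t)e_t]\in H_i(R/I)$ satisfies $\delta\bigl([(-1)^{i-1}z\wedge(f/x_t)e_t]\bigr)=[z]$. -/

import Mathlib

open CategoryTheory MvPolynomial
open scoped TensorProduct

universe u

namespace KoszulMonomial

/-! ### Monomial ideals -/

section MonomialIdeals

variable {K : Type u} [Field K] {n : ℕ}

/-- A monomial ideal of `K[x_1, …, x_n]`: an ideal generated by a set of monomials `x^a`. -/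
def IsMonomialIdeal (J : Ideal (MvPolynomial (Fin n) K)) : Prop :=
  ∃ S : Set (Fin n →₀ ℕ), J = Ideal.span ((fun a => monomial a (1 : K)) '' S)

/-- The exponents of the elements of `G(J)`, the minimal set of monomial generators of the
monomial ideal `J`: the monomials of `J` that are minimal with respect to divisibility. -/
def minimalGeneratorExponents (J : Ideal (MvPolynomial (Fin n) K)) : Set (Fin n →₀ ℕ) :=
  {a | Minimal (fun c : Fin n →₀ ℕ => monomial c (1 : K) ∈ J) a}

end MonomialIdeals

/-! ### The Koszul complex of the variables -/

section Koszul

variable {K : Type u} [Field K] {n : ℕ}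

/-- The free module `R^n` over `R = K[x_1, …, x_n]`, whose basis is `e_1, …, e_n`. -/
abbrev FreeMod (K : Type u) [Field K] (n : ℕ) : Type u := Fin n → MvPolynomial (Fin n) K

/-- The linear form `R^n → R` with `e_j ↦ x_j`. -/
noncomputable def variableForm (K : Type u) [Field K] (n : ℕ) :
    Module.Dual (MvPolynomial (Fin n) K) (FreeMod K n) :=
  Fintype.linearCombination (MvPolynomial (Fin n) K) (X : Fin n → MvPolynomial (Fin n) K)

/-- Contraction with the form `e_j ↦ x_j` on the exterior algebra of `R^n`. -/
noncomputable def contraction (K : Type u) [Field K] (n : ℕ) :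
    ExteriorAlgebra (MvPolynomial (Fin n) K) (FreeMod K n) →ₗ[MvPolynomial (Fin n) K]
      ExteriorAlgebra (MvPolynomial (Fin n) K) (FreeMod K n) :=
  CliffordAlgebra.contractLeft (variableForm K n)

theorem contraction_mem (i : ℕ) :
    ∀ z ∈ ⋀[MvPolynomial (Fin n) K]^(i + 1) (FreeMod K n),
      contraction K n z ∈ ⋀[MvPolynomial (Fin n) K]^i (FreeMod K n) := by
  induction i with
  | zero =>
    intro z hz
    rw [ExteriorAlgebra.exteriorPower, zero_add, pow_one] at hz
    obtain ⟨v, rfl⟩ := hz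
    rw [contraction, CliffordAlgebra.contractLeft_ι, ExteriorAlgebra.exteriorPower, pow_zero]
    exact Submodule.mem_one.mpr ⟨_, rfl⟩
  | succ i ih =>
    intro z hz
    rw [ExteriorAlgebra.exteriorPower, pow_succ'] at hz
    induction hz using Submodule.mul_induction_on' with
    | mem_mul_mem v hv y hy =>
      obtain ⟨v, rfl⟩ := hv
      rw [contraction, CliffordAlgebra.contractLeft_ι_mul]
      refine Submodule.sub_mem _ (Submodule.smul_mem _ _ hy) ?_
      rw [ExteriorAlgebra.exteriorPower, pow_succ']
      exact Submodule.mul_mem_mul ⟨v, rfl⟩ (ih y hy)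
    | add x _ y _ hx hy => rw [map_add]; exact Submodule.add_mem _ hx hy

/-- The Koszul differential `⋀^{i+1} R^n → ⋀^i R^n`,
`e_{j_0} ∧ ⋯ ∧ e_{j_i} ↦ ∑_k (-1)^k x_{j_k} e_{j_0} ∧ ⋯ ê_{j_k} ⋯ ∧ e_{j_i}`. -/
noncomputable def koszulD (K : Type u) [Field K] (n i : ℕ) :
    ⋀[MvPolynomial (Fin n) K]^(i + 1) (FreeMod K n) →ₗ[MvPolynomial (Fin n) K]
      ⋀[MvPolynomial (Fin n) K]^i (FreeMod K n) :=
  (contraction K n).restrict (contraction_mem i)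

theorem koszulD_comp (i : ℕ) : koszulD K n i ∘ₗ koszulD K n (i + 1) = 0 := by
  refine LinearMap.ext fun z => Subtype.ext ?_
  exact CliffordAlgebra.contractLeft_contractLeft _ _

/-- The Koszul complex `K_•(x_1, …, x_n; M)`, with `K_i(M) = ⋀^i R^n ⊗ M`. -/
noncomputable def koszulComplex (M : ModuleCat.{u} (MvPolynomial (Fin n) K)) :
    ChainComplex (ModuleCat.{u} (MvPolynomial (Fin n) K)) ℕ :=
  ChainComplex.of
    (fun i => ModuleCat.of _
      (⋀[MvPolynomial (Fin n) K]^i (FreeMod K n) ⊗[MvPolynomial (Fin n) K] M))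
    (fun i => ModuleCat.ofHom ((koszulD K n i).rTensor M))
    (fun i => by
      rw [← ModuleCat.ofHom_comp, ← LinearMap.rTensor_comp, koszulD_comp,
        LinearMap.rTensor_zero, ModuleCat.ofHom_zero])

theorem koszulComplex_d (M : ModuleCat.{u} (MvPolynomial (Fin n) K)) (i : ℕ) :
    (koszulComplex M).d (i + 1) i = ModuleCat.ofHom ((koszulD K n i).rTensor M) :=
  ChainComplex.of_d (fun i => ModuleCat.of _
      (⋀[MvPolynomial (Fin n) K]^i (FreeMod K n) ⊗[MvPolynomial (Fin n) K] M))
    (fun i => ModuleCat.ofHom ((koszulD K n i).rTensor M)) i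

/-- The map of Koszul complexes induced by a map of modules. -/
noncomputable def koszulMap {M N : ModuleCat.{u} (MvPolynomial (Fin n) K)} (φ : M ⟶ N) :
    koszulComplex M ⟶ koszulComplex N :=
  ChainComplex.ofHom
    (fun i => ModuleCat.ofHom
      (φ.hom.lTensor (⋀[MvPolynomial (Fin n) K]^i (FreeMod K n))))
    (fun i => by
      rw [koszulComplex_d, koszulComplex_d]
      apply ModuleCat.hom_ext
      exact (LinearMap.rTensor_comp_lTensor _ _ _).trans
        (LinearMap.lTensor_comp_rTensor _ _ _).symm)

/-- The element `z ⊗ m` of `K_i(M)`. -/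
noncomputable def chain (M : ModuleCat.{u} (MvPolynomial (Fin n) K)) {i : ℕ}
    (z : ⋀[MvPolynomial (Fin n) K]^i (FreeMod K n)) (m : M) : (koszulComplex M).X i :=
  z ⊗ₜ[MvPolynomial (Fin n) K] m

/-- The Koszul homology `H_i(M)`. -/
noncomputable abbrev koszulHomology (M : ModuleCat.{u} (MvPolynomial (Fin n) K)) (i : ℕ) :
    ModuleCat.{u} (MvPolynomial (Fin n) K) :=
  (koszulComplex M).homology i

/-- `IsClassOf z h`: the chain `z ∈ K_i(M)` is a cycle and `h = [z]` is its homology class. -/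
def IsClassOf {M : ModuleCat.{u} (MvPolynomial (Fin n) K)} {i : ℕ}
    (z : (koszulComplex M).X i) (h : koszulHomology M i) : Prop :=
  ∃ y : (koszulComplex M).cycles i,
    ((koszulComplex M).iCycles i).hom y = z ∧ ((koszulComplex M).homologyπ i).hom y = h

/-- The product `z ∧ v` of `z ∈ ⋀^i R^n` and `v ∈ R^n`. -/
noncomputable def wedge {i : ℕ} (z : ⋀[MvPolynomial (Fin n) K]^i (FreeMod K n))
    (v : FreeMod K n) : ⋀[MvPolynomial (Fin n) K]^(i + 1) (FreeMod K n) :=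
  ⟨(z : ExteriorAlgebra (MvPolynomial (Fin n) K) (FreeMod K n)) *
      ExteriorAlgebra.ι (MvPolynomial (Fin n) K) v,
    by
      rw [ExteriorAlgebra.exteriorPower, pow_succ]
      exact Submodule.mul_mem_mul z.2 ⟨v, rfl⟩⟩

end Koszul

/-! ### Multigradings -/

section Grading

variable {K : Type u} [Field K] {n : ℕ}

/-- The homogeneous component `R_a`, `a ∈ ℤ^n`, of `R = K[x_1, …, x_n]`: the multiples of `x^a`
by scalars if all `a_j ≥ 0`, and `0` otherwise. -/
noncomputable def polyComponent (K : Type u) [Field K] {n : ℕ} (a : Fin n → ℤ) :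
    AddSubgroup (MvPolynomial (Fin n) K) where
  carrier := {p | ∀ m : Fin n →₀ ℕ, coeff m p ≠ 0 → ∀ j, (m j : ℤ) = a j}
  zero_mem' := by intro m hm; simp at hm
  add_mem' := by
    intro p q hp hq m hm
    rw [coeff_add] at hm
    by_cases h : coeff m p = 0
    · exact hq m (by simpa [h] using hm)
    · exact hp m h
  neg_mem' := by
    intro p hp m hm
    exact hp m (by simpa using hm)

/-- The homogeneous component `(R/J)_a`, the image of `R_a`. -/
noncomputable def quotComponent (J : Ideal (MvPolynomial (Fin n) K)) (a : Fin n → ℤ) :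
    AddSubgroup (MvPolynomial (Fin n) K ⧸ J) :=
  (polyComponent K a).map (Ideal.Quotient.mk J).toAddMonoidHom

/-- The grading of the shifted module `M(-b)`: `M(-b)_a = M_{a-b}`. -/
def shiftGrading {M : Type u} [AddCommGroup M] (b : Fin n → ℤ)
    (𝒜 : (Fin n → ℤ) → AddSubgroup M) : (Fin n → ℤ) → AddSubgroup M :=
  fun a => 𝒜 (a - b)

/-- The homogeneous component `K_i(M)_a` of the Koszul complex of a `ℤ^n`-graded module `M` with
components `𝒜 a`. It is generated by the `e_{v_1} ∧ ⋯ ∧ e_{v_i} ⊗ m` with `m` homogeneous of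
degree `a - ε_{v_1} - ⋯ - ε_{v_i}`; here `e_j` has multidegree `ε_j`, the `j`-th unit vector. -/
noncomputable def koszulComponent (M : ModuleCat.{u} (MvPolynomial (Fin n) K))
    (𝒜 : (Fin n → ℤ) → AddSubgroup M) (i : ℕ) (a : Fin n → ℤ) :
    AddSubgroup ((koszulComplex M).X i) :=
  AddSubgroup.closure {w | ∃ (v : Fin i → Fin n) (m : M),
    m ∈ 𝒜 (a - ∑ k, Pi.single (v k) (1 : ℤ)) ∧
    w = chain M (exteriorPower.ιMulti (MvPolynomial (Fin n) K) i
      (fun k => (Pi.single (v k) 1 : FreeMod K n))) m}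

/-- The homogeneous component `H_i(M)_a` of the Koszul homology of a `ℤ^n`-graded module `M`:
the classes of the cycles in `K_i(M)_a`. -/
noncomputable def homologyComponent (M : ModuleCat.{u} (MvPolynomial (Fin n) K))
    (𝒜 : (Fin n → ℤ) → AddSubgroup M) (i : ℕ) (a : Fin n → ℤ) :
    AddSubgroup (koszulHomology M i) :=
  ((koszulComponent M 𝒜 i a).comap
    ((koszulComplex M).iCycles i).hom.toAddMonoidHom).map
      ((koszulComplex M).homologyπ i).hom.toAddMonoidHom

end Grading

/-! ### The sequence `0 → R/(J:I) → R/J → R/I → 0` for `I = (J, f)` -/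

section Sequence

variable {K : Type u} [Field K] {n : ℕ}

/-- The ideal `I = (J, f)`. -/
noncomputable abbrev adjoin (J : Ideal (MvPolynomial (Fin n) K)) (f : MvPolynomial (Fin n) K) :
    Ideal (MvPolynomial (Fin n) K) :=
  J ⊔ Ideal.span {f}

/-- The ideal `J : I` for `I = (J, f)`. -/
noncomputable abbrev colonIdeal (J : Ideal (MvPolynomial (Fin n) K)) (f : MvPolynomial (Fin n) K) :
    Ideal (MvPolynomial (Fin n) K) :=
  Submodule.colon J (adjoin J f : Set (MvPolynomial (Fin n) K))

/-- The `R`-module `R/J`. -/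
noncomputable abbrev quot (J : Ideal (MvPolynomial (Fin n) K)) :
    ModuleCat.{u} (MvPolynomial (Fin n) K) :=
  ModuleCat.of _ (MvPolynomial (Fin n) K ⧸ J)

theorem mem_colonIdeal (J : Ideal (MvPolynomial (Fin n) K)) (f g : MvPolynomial (Fin n) K) :
    g ∈ colonIdeal J f ↔ f * g ∈ J := by
  rw [Submodule.mem_colon]
  constructor
  · intro h
    rw [mul_comm]
    exact h f (Ideal.mem_sup_right (Ideal.mem_span_singleton_self f))
  · intro h s hs
    obtain ⟨p, hp, q, hq, rfl⟩ := Submodule.mem_sup.mp hs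
    obtain ⟨r, rfl⟩ := Ideal.mem_span_singleton'.mp hq
    rw [smul_add]
    refine J.add_mem (J.mul_mem_left _ hp) ?_
    have : g • (r * f) = r * (f * g) := by rw [smul_eq_mul]; ring
    rw [this]
    exact J.mul_mem_left _ h

/-- Multiplication by `f`, as a map `R/(J:I) → R/J`. -/
noncomputable def mulMap (J : Ideal (MvPolynomial (Fin n) K)) (f : MvPolynomial (Fin n) K) :
    quot (colonIdeal J f) ⟶ quot J :=
  ModuleCat.ofHom (Submodule.mapQ (colonIdeal J f) J (LinearMap.mulLeft _ f)
    (fun g hg => (mem_colonIdeal J f g).mp hg))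

/-- The canonical map `R/J → R/I`. -/
noncomputable def projMap (J : Ideal (MvPolynomial (Fin n) K)) (f : MvPolynomial (Fin n) K) :
    quot J ⟶ quot (adjoin J f) :=
  ModuleCat.ofHom (Submodule.mapQ J (adjoin J f) LinearMap.id le_sup_left)

theorem mulMap_injective (J : Ideal (MvPolynomial (Fin n) K)) (f : MvPolynomial (Fin n) K) :
    Function.Injective (mulMap J f).hom := by
  rw [injective_iff_map_eq_zero]
  intro y hy
  obtain ⟨g, rfl⟩ := Submodule.Quotient.mk_surjective _ y
  have hg : Submodule.Quotient.mk (p := J) (f * g) = 0 := hy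
  rw [Submodule.Quotient.mk_eq_zero] at hg ⊢
  exact (mem_colonIdeal J f g).mpr hg

theorem projMap_surjective (J : Ideal (MvPolynomial (Fin n) K)) (f : MvPolynomial (Fin n) K) :
    Function.Surjective (projMap J f).hom := by
  intro y
  obtain ⟨g, rfl⟩ := Submodule.Quotient.mk_surjective _ y
  exact ⟨Submodule.Quotient.mk g, rfl⟩

theorem mulMap_projMap_exact (J : Ideal (MvPolynomial (Fin n) K))
    (f : MvPolynomial (Fin n) K) :
    Function.Exact (mulMap J f).hom (projMap J f).hom := by
  intro y
  obtain ⟨g, rfl⟩ := Submodule.Quotient.mk_surjective _ y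
  constructor
  · intro hy
    have hg : Submodule.Quotient.mk (p := adjoin J f) g = 0 := hy
    rw [Submodule.Quotient.mk_eq_zero] at hg
    obtain ⟨p, hp, q, hq, rfl⟩ := Submodule.mem_sup.mp hg
    obtain ⟨r, rfl⟩ := Ideal.mem_span_singleton'.mp hq
    refine ⟨Submodule.Quotient.mk r, ?_⟩
    change Submodule.Quotient.mk (p := J) (f * r) = _
    rw [Submodule.Quotient.eq]
    have : f * r - (p + r * f) = -p := by ring
    rw [this]
    exact J.neg_mem hp
  · rintro ⟨x, hx⟩
    obtain ⟨r, rfl⟩ := Submodule.Quotient.mk_surjective _ x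
    rw [← hx]
    change Submodule.Quotient.mk (p := adjoin J f) (f * r) = 0
    rw [Submodule.Quotient.mk_eq_zero]
    exact Ideal.mem_sup_right (Ideal.mul_mem_right _ _ (Ideal.mem_span_singleton_self f))

/-- The sequence of Koszul complexes `0 → K_•(R/(J:I)) → K_•(R/J) → K_•(R/I) → 0`, `I = (J, f)`,
induced by multiplication by `f` and by the canonical projection. -/
noncomputable def koszulSequence (J : Ideal (MvPolynomial (Fin n) K))
    (f : MvPolynomial (Fin n) K) :
    ShortComplex (ChainComplex (ModuleCat.{u} (MvPolynomial (Fin n) K)) ℕ) where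
  X₁ := koszulComplex (quot (colonIdeal J f))
  X₂ := koszulComplex (quot J)
  X₃ := koszulComplex (quot (adjoin J f))
  f := koszulMap (mulMap J f)
  g := koszulMap (projMap J f)
  zero := by
    ext i : 1
    apply ModuleCat.hom_ext
    change (projMap J f).hom.lTensor _ ∘ₗ (mulMap J f).hom.lTensor _ = 0
    rw [← LinearMap.lTensor_comp, (mulMap_projMap_exact J f).linearMap_comp_eq_zero,
      LinearMap.lTensor_zero]

theorem koszulSequence_shortExact (J : Ideal (MvPolynomial (Fin n) K))
    (f : MvPolynomial (Fin n) K) : (koszulSequence J f).ShortExact := by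
  apply HomologicalComplex.shortExact_of_degreewise_shortExact
  intro i
  refine @ShortComplex.ShortExact.mk _ _ _ _ ?_ ?_ ?_
  · rw [ShortComplex.ShortExact.moduleCat_exact_iff_function_exact]
    exact lTensor_exact _ (mulMap_projMap_exact J f) (projMap_surjective J f)
  · rw [ModuleCat.mono_iff_injective]
    exact Module.Flat.lTensor_preserves_injective_linearMap _ (mulMap_injective J f)
  · rw [ModuleCat.epi_iff_surjective]
    exact LinearMap.lTensor_surjective _ (projMap_surjective J f)

/-- The canonical map `H_i(R/J) → H_i(R/I)`, `I = (J, f)`. -/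
noncomputable def homologyProj (J : Ideal (MvPolynomial (Fin n) K))
    (f : MvPolynomial (Fin n) K) (i : ℕ) :
    koszulHomology (quot J) i ⟶ koszulHomology (quot (adjoin J f)) i :=
  HomologicalComplex.homologyMap (koszulMap (projMap J f)) i

/-- The connecting homomorphism `δ : H_{i+1}(R/I) → H_i(R/(J:I))`, `I = (J, f)`. -/
noncomputable def connecting (J : Ideal (MvPolynomial (Fin n) K))
    (f : MvPolynomial (Fin n) K) (i : ℕ) :
    koszulHomology (quot (adjoin J f)) (i + 1) ⟶ koszulHomology (quot (colonIdeal J f)) i :=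
  (koszulSequence_shortExact J f).δ (i + 1) i rfl

end Sequence

end KoszulMonomial

open KoszulMonomial

namespace KoszulMonomial
-- Monomial ideals: cancelling `x_t`, and dividing by a monomial degree by degree
section MonomialIdeals
variable {K : Type u} [Field K] {n : ℕ}

/-! Since `x_t` divides no minimal generator of `J`, it is a nonzerodivisor modulo `J`. Hence `f g ∈
J` forces `(f/x_t) g ∈ J`, so multiplication by `f/x_t` is well defined from `R/(J:I)` to `R/J`, and
multiplication by `f` is `x_t` times it. Wedging with `e_t` turns the factor `x_t` into a homotopy:
by the Leibniz rule, `z ↦ (-1)^i z ∧ (f/x_t) e_t` has boundary `f z` on every cycle `z`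
(`d_wedgeDiv_iCycles`).

So this chain over `R/J` becomes a cycle over `R/I`, and the snake recipe for `δ` returns `[z]`
(`exists_cycle_connecting_eq`). Thus `δ` is surjective in every degree, and the long exact homology
sequence breaks into short exact ones.

Homogeneity of `δ` follows the same recipe with homogeneous choices: lift, differentiate, divide by
`f`. In the basis of wedges `e_S` (`mem_koszulComponent_iff`) lifting and division become statements
about coefficients in `R/I` and `R/J`; division by `f` respects degrees because `J` is monomial
(`mem_quotComponent_of_mulMap_mem`). -/

theorem IsMonomialIdeal.mem_iff {J : Ideal (MvPolynomial (Fin n) K)} (hJ : IsMonomialIdeal J)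
    (p : MvPolynomial (Fin n) K) : p ∈ J ↔ ∀ m ∈ p.support, monomial m (1 : K) ∈ J := by
  obtain ⟨S, rfl⟩ := hJ
  rw [mem_ideal_span_monomial_image]
  refine forall₂_congr fun m _ => ?_
  rw [mem_ideal_span_monomial_image]
  simp

theorem monomial_mem_of_le {J : Ideal (MvPolynomial (Fin n) K)} {a c : Fin n →₀ ℕ}
    (ha : monomial a (1 : K) ∈ J) (hac : a ≤ c) : monomial c (1 : K) ∈ J := by
  rw [← tsub_add_cancel_of_le hac, ← one_mul (1 : K), ← monomial_mul]
  exact J.mul_mem_left _ ha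

/-- Some minimal generator divides `x^c x_t`; its exponent at `t` is zero, so it already divides
`x^c`. -/
theorem monomial_mem_of_add_single_mem {J : Ideal (MvPolynomial (Fin n) K)} {t : Fin n}
    (htJ : ∀ a ∈ minimalGeneratorExponents J, a t = 0) {c : Fin n →₀ ℕ}
    (hc : monomial (c + Finsupp.single t 1) (1 : K) ∈ J) : monomial c (1 : K) ∈ J := by
  obtain ⟨a, hac, ha⟩ := exists_minimal_le_of_wellFoundedLT
    (fun c : Fin n →₀ ℕ => monomial c (1 : K) ∈ J) _ hc
  refine monomial_mem_of_le ha.prop fun j => ?_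
  by_cases hj : j = t
  · subst hj
    rw [htJ a ha]
    exact Nat.zero_le _
  · simpa [Finsupp.single_eq_of_ne hj] using hac j

/-- If `x_t` divides no minimal generator of the monomial ideal `J`, then `x_t` is a
nonzerodivisor modulo `J`. -/
theorem mem_of_X_mul_mem {J : Ideal (MvPolynomial (Fin n) K)} (hJ : IsMonomialIdeal J)
    {t : Fin n} (htJ : ∀ a ∈ minimalGeneratorExponents J, a t = 0)
    {p : MvPolynomial (Fin n) K} (hp : X t * p ∈ J) : p ∈ J := by
  rw [hJ.mem_iff] at hp ⊢
  intro m hm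
  refine monomial_mem_of_add_single_mem htJ (hp _ ?_)
  rw [add_comm, mem_support_iff, coeff_X_mul]
  exact mem_support_iff.mp hm

theorem X_mul_monomial_sub {b : Fin n →₀ ℕ} {t : Fin n} (ht : b t ≠ 0) :
    X t * monomial (b - Finsupp.single t 1) (1 : K) = monomial b 1 := by
  rw [X, monomial_mul, one_mul, add_tsub_cancel_of_le]
  rw [Finsupp.single_le_iff]
  omega

/-- If `fy` is homogeneous of degree `c` in `R/J`, `f` a monomial of degree `b`, then
`y ∈ R/(J : f)` is homogeneous of degree `c - b`. -/
theorem mem_quotComponent_of_mulMap_mem {J : Ideal (MvPolynomial (Fin n) K)}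
    (hJ : IsMonomialIdeal J) (b : Fin n →₀ ℕ) (c : Fin n → ℤ)
    (y : quot (colonIdeal J (monomial b 1)))
    (hy : (mulMap J (monomial b 1)).hom y ∈ quotComponent J c) :
    y ∈ quotComponent (colonIdeal J (monomial b 1)) (c - fun j => (b j : ℤ)) := by
  classical
  obtain ⟨g, rfl⟩ := Submodule.Quotient.mk_surjective _ y
  obtain ⟨q, hq, hqg⟩ := hy
  have hqg' : q - monomial b 1 * g ∈ J := (Submodule.Quotient.eq J).mp hqg
  rw [hJ.mem_iff] at hqg'
  -- The homogeneous representative keeps exactly those terms of `g` that `f` moves into degree `c`.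
  let g' : MvPolynomial (Fin n) K := g.support.sum fun m =>
    if ∀ j, ((b + m) j : ℤ) = c j then monomial m (coeff m g) else 0
  have hg' : ∀ m, coeff m g' = if ∀ j, ((b + m) j : ℤ) = c j then coeff m g else 0 := by
    intro m
    simp only [g', coeff_sum]
    rw [Finset.sum_eq_single m]
    · split_ifs <;> simp
    · intro k _ hk
      split_ifs <;> simp [coeff_monomial, hk]
    · intro hm
      rw [notMem_support_iff] at hm
      simp [hm]
  refine ⟨g', ?_, ?_⟩
  · intro m hm j
    rw [hg'] at hm
    have h := (ite_ne_right_iff.mp hm).1 j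
    simp only [Finsupp.add_apply, Nat.cast_add] at h
    simp only [Pi.sub_apply]
    omega
  · refine (Submodule.Quotient.eq _).mpr ((mem_colonIdeal _ _ _).mpr ?_)
    rw [hJ.mem_iff]
    intro m hm
    rw [mem_support_iff, coeff_monomial_mul'] at hm
    obtain ⟨hbm, hm⟩ := ite_ne_right_iff.mp hm
    rw [one_mul, coeff_sub, hg', add_tsub_cancel_of_le hbm] at hm
    -- A monomial surviving in `f (g' - g)` lies outside degree `c`. There `q` has no term, so the
    -- monomial occurs in `q - f g ∈ J` and hence lies in `J`.
    have hmc : ¬ ∀ j, (m j : ℤ) = c j := by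
      intro h
      rw [if_pos h] at hm
      simp at hm
    rw [if_neg hmc, zero_sub, neg_ne_zero] at hm
    refine hqg' m ?_
    have hqm : coeff m q = 0 := by
      by_contra h
      exact hmc (hq m h)
    rw [mem_support_iff, coeff_sub, hqm, coeff_monomial_mul', if_pos hbm, one_mul, zero_sub]
    exact neg_ne_zero.mpr hm

theorem smul_X_mem_quotComponent (J : Ideal (MvPolynomial (Fin n) K)) (c : Fin n → ℤ) (j : Fin n)
    (y : quot J) (hy : y ∈ quotComponent J c) :
    (X j : MvPolynomial (Fin n) K) • y ∈ quotComponent J (c + Pi.single j 1) := by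
  classical
  obtain ⟨p, hp, rfl⟩ := hy
  refine ⟨X j * p, ?_, rfl⟩
  intro m hm k
  rw [coeff_X_mul'] at hm
  obtain ⟨hjm, hm⟩ := ite_ne_right_iff.mp hm
  have h := hp _ hm k
  have hjm' : m j ≠ 0 := Finsupp.mem_support_iff.mp hjm
  simp only [Finsupp.coe_tsub, Pi.sub_apply] at h
  simp only [Pi.add_apply]
  by_cases hk : k = j
  · subst hk
    simp only [Finsupp.single_eq_same, Pi.single_eq_same] at h ⊢
    omega
  · rw [Finsupp.single_eq_of_ne hk] at h
    rw [Pi.single_eq_of_ne hk]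
    simpa using h

end MonomialIdeals

/-! ### The Leibniz rule and the explicit Koszul differential -/

section Contraction
variable {K : Type u} [Field K] {n : ℕ}

theorem contraction_ι_mul (v : FreeMod K n)
    (y : ExteriorAlgebra (MvPolynomial (Fin n) K) (FreeMod K n)) :
    contraction K n (ExteriorAlgebra.ι (MvPolynomial (Fin n) K) v * y) =
      variableForm K n v • y - ExteriorAlgebra.ι (MvPolynomial (Fin n) K) v * contraction K n y :=
  CliffordAlgebra.contractLeft_ι_mul _ _ _

/-- The Leibniz rule for a vector on the right: peel factors off the left of `z`, each contributing
one sign, until a scalar remains, which contraction kills. -/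
theorem contraction_mul_ι (v : FreeMod K n) (i : ℕ) :
    ∀ z ∈ ⋀[MvPolynomial (Fin n) K]^i (FreeMod K n),
      contraction K n (z * ExteriorAlgebra.ι (MvPolynomial (Fin n) K) v) =
        contraction K n z * ExteriorAlgebra.ι (MvPolynomial (Fin n) K) v +
          (-1 : ℤ) ^ i • variableForm K n v • z := by
  induction i with
  | zero =>
    intro z hz
    rw [ExteriorAlgebra.exteriorPower, pow_zero] at hz
    obtain ⟨r, rfl⟩ := Submodule.mem_one.mp hz
    rw [contraction, ExteriorAlgebra.ι, CliffordAlgebra.contractLeft_algebraMap_mul,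
      CliffordAlgebra.contractLeft_ι, CliffordAlgebra.contractLeft_algebraMap, zero_mul, zero_add,
      pow_zero, one_smul, Algebra.smul_def, Algebra.commutes]
  | succ i ih =>
    intro z hz
    rw [ExteriorAlgebra.exteriorPower, pow_succ'] at hz
    induction hz using Submodule.mul_induction_on' with
    | mem_mul_mem w hw y hy =>
      obtain ⟨w, rfl⟩ := hw
      rw [mul_assoc, contraction_ι_mul, ih y hy, contraction_ι_mul, mul_add, sub_mul,
        pow_succ, mul_smul_comm, mul_smul_comm, smul_mul_assoc, mul_assoc, mul_neg_one, neg_smul]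
      abel
    | add x _ y _ hx hy =>
      rw [add_mul, map_add, hx, hy, map_add, add_mul, smul_add, smul_add]
      abel

theorem contraction_ιMulti (i : ℕ) (v : Fin (i + 1) → FreeMod K n) :
    contraction K n (ExteriorAlgebra.ιMulti (MvPolynomial (Fin n) K) (i + 1) v) =
      ∑ k : Fin (i + 1), (-1 : ℤ) ^ (k : ℕ) • variableForm K n (v k) •
        ExteriorAlgebra.ιMulti (MvPolynomial (Fin n) K) i (fun l => v (k.succAbove l)) := by
  induction i with
  | zero =>
    rw [ExteriorAlgebra.ιMulti_succ_apply]
    simp only [ExteriorAlgebra.ιMulti_zero_apply, mul_one]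
    rw [contraction, ExteriorAlgebra.ι, CliffordAlgebra.contractLeft_ι,
      Algebra.algebraMap_eq_smul_one, Fin.sum_univ_succ, Fin.sum_univ_zero, add_zero, Fin.val_zero,
      pow_zero, one_smul]
  | succ i ih =>
    rw [ExteriorAlgebra.ιMulti_succ_apply]
    rw [contraction_ι_mul, ih (Matrix.vecTail v), Finset.mul_sum, sub_eq_add_neg,
      ← Finset.sum_neg_distrib]
    conv_rhs => rw [Fin.sum_univ_succ]
    congr 1
    · simp only [Fin.val_zero, pow_zero, one_smul, Fin.zero_succAbove]
      rfl
    · refine Finset.sum_congr rfl fun k _ => ?_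
      rw [ExteriorAlgebra.ιMulti_succ_apply, Fin.val_succ, pow_succ, mul_neg_one, neg_smul]
      rw [mul_smul_comm, mul_smul_comm]
      simp only [Matrix.vecTail, Function.comp_def, Fin.succ_succAbove_succ, Fin.succ_succAbove_zero]

end Contraction

/-! ### Cycles, classes and the long exact sequence -/

section Homology
variable {K : Type u} [Field K] {n : ℕ}

theorem iCycles_injective (M : ModuleCat.{u} (MvPolynomial (Fin n) K)) (i : ℕ) :
    Function.Injective ((koszulComplex M).iCycles i).hom :=
  (ModuleCat.mono_iff_injective _).mp inferInstance

theorem homologyπ_surjective (M : ModuleCat.{u} (MvPolynomial (Fin n) K)) (i : ℕ) :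
    Function.Surjective ((koszulComplex M).homologyπ i).hom :=
  (ModuleCat.epi_iff_surjective _).mp inferInstance

theorem d_iCycles (M : ModuleCat.{u} (MvPolynomial (Fin n) K)) (i j : ℕ)
    (y : (koszulComplex M).cycles i) :
    ((koszulComplex M).d i j).hom (((koszulComplex M).iCycles i).hom y) = 0 := by
  rw [← LinearMap.comp_apply, ← ModuleCat.hom_comp, HomologicalComplex.iCycles_d]
  rfl

theorem exists_iCycles_eq (M : ModuleCat.{u} (MvPolynomial (Fin n) K)) {i : ℕ}
    (x : (koszulComplex M).X i) (hx : ∀ j, ((koszulComplex M).d i j).hom x = 0) :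
    ∃ y : (koszulComplex M).cycles i, ((koszulComplex M).iCycles i).hom y = x :=
  ⟨(koszulComplex M).cyclesMk x _ rfl (hx _), (koszulComplex M).i_cyclesMk x _ rfl (hx _)⟩

theorem homologyMap_homologyπ {M N : ModuleCat.{u} (MvPolynomial (Fin n) K)} (φ : M ⟶ N) {i : ℕ}
    (y : (koszulComplex M).cycles i) :
    ∃ y' : (koszulComplex N).cycles i,
      ((koszulComplex N).iCycles i).hom y' =
        ((koszulMap φ).f i).hom (((koszulComplex M).iCycles i).hom y) ∧
      (HomologicalComplex.homologyMap (koszulMap φ) i).hom (((koszulComplex M).homologyπ i).hom y) =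
        ((koszulComplex N).homologyπ i).hom y' := by
  refine ⟨(HomologicalComplex.cyclesMap (koszulMap φ) i).hom y, ?_, ?_⟩
  · exact congr($(HomologicalComplex.cyclesMap_i (koszulMap φ) i).hom y)
  · exact congr($(HomologicalComplex.homologyπ_naturality (koszulMap φ) i).hom y)

theorem koszulMap_d {M N : ModuleCat.{u} (MvPolynomial (Fin n) K)} (φ : M ⟶ N) (i j : ℕ)
    (x : (koszulComplex M).X i) :
    ((koszulComplex N).d i j).hom (((koszulMap φ).f i).hom x) =
      ((koszulMap φ).f j).hom (((koszulComplex M).d i j).hom x) :=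
  congr($((koszulMap φ).comm i j).hom x)

theorem d_succ_chain (M : ModuleCat.{u} (MvPolynomial (Fin n) K)) {i : ℕ}
    (z : ⋀[MvPolynomial (Fin n) K]^(i + 1) (FreeMod K n)) (m : M) :
    ((koszulComplex M).d (i + 1) i).hom (chain M z m) = chain M (koszulD K n i z) m := by
  rw [koszulComplex_d]
  rfl

theorem chain_induction {M : ModuleCat.{u} (MvPolynomial (Fin n) K)} {i : ℕ}
    {p : (koszulComplex M).X i → Prop} (h : ∀ z m, p (chain M z m)) (h0 : p 0)
    (hadd : ∀ x y, p x → p y → p (x + y)) (x : (koszulComplex M).X i) : p x :=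
  TensorProduct.induction_on (motive := p) x h0 h hadd

theorem koszulMap_exact (J : Ideal (MvPolynomial (Fin n) K))
    (f : MvPolynomial (Fin n) K) (i : ℕ) :
    Function.Exact ((koszulMap (mulMap J f)).f i).hom ((koszulMap (projMap J f)).f i).hom :=
  lTensor_exact _ (mulMap_projMap_exact J f) (projMap_surjective J f)

/-- The connecting homomorphism on cycles: if `x ∈ K_{i+1}(R/J)` lifts the cycle `y` and
`∂x = f y'`, then `δ[y] = [y']`. -/
theorem connecting_homologyπ (J : Ideal (MvPolynomial (Fin n) K)) (f : MvPolynomial (Fin n) K)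
    {i : ℕ} (y : (koszulComplex (quot (adjoin J f))).cycles (i + 1))
    (y' : (koszulComplex (quot (colonIdeal J f))).cycles i)
    (x : (koszulComplex (quot J)).X (i + 1))
    (hy : ((koszulMap (projMap J f)).f (i + 1)).hom x =
      ((koszulComplex (quot (adjoin J f))).iCycles (i + 1)).hom y)
    (hy' : ((koszulMap (mulMap J f)).f i).hom
        (((koszulComplex (quot (colonIdeal J f))).iCycles i).hom y') =
      ((koszulComplex (quot J)).d (i + 1) i).hom x) :
    (connecting J f i).hom (((koszulComplex (quot (adjoin J f))).homologyπ (i + 1)).hom y) =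
      ((koszulComplex (quot (colonIdeal J f))).homologyπ i).hom y' := by
  have h := (koszulSequence_shortExact J f).δ_apply (i + 1) i rfl
    (((koszulComplex (quot (adjoin J f))).iCycles (i + 1)).hom y) (d_iCycles _ _ _ y) x hy
    (((koszulComplex (quot (colonIdeal J f))).iCycles i).hom y') hy' _ rfl
  have h3 : (koszulSequence J f).X₃.cyclesMk
      (((koszulComplex (quot (adjoin J f))).iCycles (i + 1)).hom y) i
      (ComplexShape.next_eq' _ rfl) (d_iCycles _ _ _ y) = y :=
    iCycles_injective _ _ ((koszulSequence J f).X₃.i_cyclesMk _ _ _ _)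
  have h1 : (koszulSequence J f).X₁.cyclesMk
      (((koszulComplex (quot (colonIdeal J f))).iCycles i).hom y') _ rfl (d_iCycles _ _ _ y') = y' :=
    iCycles_injective _ _ ((koszulSequence J f).X₁.i_cyclesMk _ _ _ _)
  rw [h3] at h
  exact h.trans (congrArg ((koszulComplex (quot (colonIdeal J f))).homologyπ i).hom h1)

theorem homologyProj_connecting_exact (J : Ideal (MvPolynomial (Fin n) K))
    (f : MvPolynomial (Fin n) K) (i : ℕ) :
    Function.Exact (homologyProj J f (i + 1)).hom (connecting J f i).hom :=
  (ShortComplex.ShortExact.moduleCat_exact_iff_function_exact _).mp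
    ((koszulSequence_shortExact J f).homology_exact₃ (i + 1) i rfl)

/-- The kernel is the image of multiplication by `f` on homology. If every class of `H_i(R/(J:I))`
is a value of `δ`, exactness one step earlier makes that image zero. -/
theorem homologyProj_injective_of_connecting_surjective (J : Ideal (MvPolynomial (Fin n) K))
    (f : MvPolynomial (Fin n) K) (i : ℕ) (h : Function.Surjective (connecting J f i).hom) :
    Function.Injective (homologyProj J f i).hom := by
  have h1 := (ShortComplex.ShortExact.moduleCat_exact_iff_function_exact _).mp
    ((koszulSequence_shortExact J f).homology_exact₁ (i + 1) i rfl)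
  have h2 := (ShortComplex.ShortExact.moduleCat_exact_iff_function_exact _).mp
    ((koszulSequence_shortExact J f).homology_exact₂ i)
  rw [injective_iff_map_eq_zero]
  intro x hx
  obtain ⟨y, rfl⟩ := (h2 x).mp hx
  obtain ⟨w, rfl⟩ := h y
  exact (h1 _).mpr ⟨w, rfl⟩

end Homology

/-! ### The homotopy given by `e_t` and `f/x_t` -/

section WedgeDiv
variable {K : Type u} [Field K] {n : ℕ}

/-- Degree `0` stands apart: no differential leaves it, so the Leibniz rule has only its second
term. -/
theorem koszulD_wedge_zero (z : ⋀[MvPolynomial (Fin n) K]^0 (FreeMod K n)) (v : FreeMod K n) :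
    koszulD K n 0 (wedge z v) = variableForm K n v • z := by
  apply Subtype.ext
  have h := contraction_mul_ι v 0 _ z.2
  obtain ⟨r, hr⟩ : ∃ r, algebraMap (MvPolynomial (Fin n) K) _ r = z.1 := by
    obtain ⟨z, hz⟩ := z
    rw [ExteriorAlgebra.exteriorPower, pow_zero] at hz
    exact Submodule.mem_one.mp hz
  rw [← hr] at h
  have h0 : contraction K n (algebraMap (MvPolynomial (Fin n) K)
      (ExteriorAlgebra (MvPolynomial (Fin n) K) (FreeMod K n)) r) = 0 :=
    CliffordAlgebra.contractLeft_algebraMap _ _ _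
  rw [h0, zero_mul, zero_add, pow_zero, one_smul, hr] at h
  exact h

theorem koszulD_wedge_succ {i : ℕ} (z : ⋀[MvPolynomial (Fin n) K]^(i + 1) (FreeMod K n))
    (v : FreeMod K n) :
    koszulD K n (i + 1) (wedge z v) =
      wedge (koszulD K n i z) v + (-1 : ℤ) ^ (i + 1) • variableForm K n v • z :=
  Subtype.ext (contraction_mul_ι v (i + 1) _ z.2)

/-- Right multiplication by `v ∈ R^n`, `⋀^i R^n → ⋀^{i+1} R^n`. -/
noncomputable def wedgeRight (v : FreeMod K n) (i : ℕ) :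
    ⋀[MvPolynomial (Fin n) K]^i (FreeMod K n) →ₗ[MvPolynomial (Fin n) K]
      ⋀[MvPolynomial (Fin n) K]^(i + 1) (FreeMod K n) where
  toFun z := wedge z v
  map_add' _ _ := Subtype.ext (add_mul _ _ _)
  map_smul' _ _ := Subtype.ext (smul_mul_assoc _ _ _)

theorem variableForm_single (t : Fin n) (p : MvPolynomial (Fin n) K) :
    variableForm K n (Pi.single t p) = p * X t := by
  rw [variableForm, Fintype.linearCombination_apply_single, smul_eq_mul]

theorem wedge_single {i : ℕ} (z : ⋀[MvPolynomial (Fin n) K]^i (FreeMod K n)) (t : Fin n)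
    (p : MvPolynomial (Fin n) K) : wedge z (Pi.single t p) = p • wedge z (Pi.single t 1) := by
  apply Subtype.ext
  change z.1 * ExteriorAlgebra.ι _ _ = p • (z.1 * ExteriorAlgebra.ι _ _)
  rw [← mul_smul_comm, ← map_smul, ← Pi.single_smul, smul_eq_mul, mul_one]

variable {J : Ideal (MvPolynomial (Fin n) K)} (hJ : IsMonomialIdeal J) {b : Fin n →₀ ℕ} {t : Fin n}
  (ht : b t ≠ 0) (htJ : ∀ a ∈ minimalGeneratorExponents J, a t = 0)

/-- Multiplication by `f/x_t`, as a map `R/(J : I) → R/J`. -/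
noncomputable def divMap (hJ : IsMonomialIdeal J) (ht : b t ≠ 0)
    (htJ : ∀ a ∈ minimalGeneratorExponents J, a t = 0) :
    (quot (colonIdeal J (monomial b 1)) : Type u) →ₗ[MvPolynomial (Fin n) K] quot J :=
  Submodule.mapQ (colonIdeal J (monomial b 1)) J
    (LinearMap.mulLeft _ (monomial (b - Finsupp.single t 1) 1))
    -- If `f g ∈ J`, then `x_t · (f/x_t) g ∈ J`, and `x_t` cancels modulo `J`.
    (fun g hg => mem_of_X_mul_mem hJ htJ (by
      rw [LinearMap.mulLeft_apply, ← mul_assoc, X_mul_monomial_sub ht]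
      exact (mem_colonIdeal _ _ _).mp hg))

theorem X_smul_divMap (y : quot (colonIdeal J (monomial b 1))) :
    (X t : MvPolynomial (Fin n) K) • divMap hJ ht htJ y = (mulMap J (monomial b 1)).hom y := by
  obtain ⟨g, rfl⟩ := Submodule.Quotient.mk_surjective _ y
  change Submodule.Quotient.mk (p := J) (X t * (monomial (b - Finsupp.single t 1) 1 * g)) =
    Submodule.Quotient.mk (p := J) (monomial b 1 * g)
  rw [← mul_assoc, X_mul_monomial_sub ht]

/-- The map `K_i(R/(J : I)) → K_{i+1}(R/J)`, `z ⊗ m ↦ (z ∧ e_t) ⊗ (f/x_t) m`. -/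
noncomputable def wedgeDiv (hJ : IsMonomialIdeal J) (ht : b t ≠ 0)
    (htJ : ∀ a ∈ minimalGeneratorExponents J, a t = 0) (i : ℕ) :
    (koszulComplex (quot (colonIdeal J (monomial b 1)))).X i →ₗ[MvPolynomial (Fin n) K]
      (koszulComplex (quot J)).X (i + 1) :=
  TensorProduct.map (wedgeRight (Pi.single t 1) i) (divMap hJ ht htJ)

theorem wedgeDiv_chain {i : ℕ} (z : ⋀[MvPolynomial (Fin n) K]^i (FreeMod K n))
    (m : quot (colonIdeal J (monomial b 1))) :
    wedgeDiv hJ ht htJ i (chain _ z m) =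
      chain _ (wedge z (Pi.single t 1)) (divMap hJ ht htJ m) := rfl

/-- Links the chain named in the theorem to a map defined on all of `K_i(R/(J:I))`; this is why that
chain depends only on `z ⊗ 1`. -/
theorem koszulMap_projMap_wedgeDiv {i : ℕ} (z : ⋀[MvPolynomial (Fin n) K]^i (FreeMod K n)) :
    ((koszulMap (projMap J (monomial b 1))).f (i + 1)).hom
        ((-1 : ℤ) ^ i • wedgeDiv hJ ht htJ i (chain _ z 1)) =
      chain (quot (adjoin J (monomial b 1)))
        ((-1 : ℤ) ^ i • wedge z (Pi.single t (monomial (b - Finsupp.single t 1) 1))) 1 := by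
  rw [map_zsmul, wedge_single]
  have h : (projMap J (monomial b 1)).hom (divMap hJ ht htJ 1) =
      (monomial (b - Finsupp.single t 1) 1 : MvPolynomial (Fin n) K) •
        (1 : quot (adjoin J (monomial b 1))) := rfl
  have h2 : ((koszulMap (projMap J (monomial b 1))).f (i + 1)).hom
      (wedgeDiv hJ ht htJ i (chain _ z 1)) =
      chain _ (wedge z (Pi.single t 1)) ((projMap J (monomial b 1)).hom (divMap hJ ht htJ 1)) := rfl
  rw [h2, h]
  simp only [chain]
  rw [TensorProduct.tmul_smul, ← TensorProduct.smul_tmul']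
  exact (TensorProduct.smul_tmul' _ _ _)

theorem d_wedgeDiv_zero (x : (koszulComplex (quot (colonIdeal J (monomial b 1)))).X 0) :
    ((koszulComplex (quot J)).d 1 0).hom (wedgeDiv hJ ht htJ 0 x) =
      ((koszulMap (mulMap J (monomial b 1))).f 0).hom x := by
  induction x using chain_induction with
  | h z m =>
    rw [wedgeDiv_chain, d_succ_chain, koszulD_wedge_zero, variableForm_single, one_mul]
    refine (TensorProduct.smul_tmul _ _ _).trans ?_
    rw [X_smul_divMap]
    rfl
  | h0 => simp only [map_zero]
  | hadd x y hx hy => simp only [map_add, hx, hy]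

/-- Up to sign, `wedgeDiv` is a null homotopy of multiplication by `f`: the Leibniz term of `e_t`
yields `x_t`, which combines with `f/x_t`. -/
theorem d_wedgeDiv_succ {i : ℕ}
    (x : (koszulComplex (quot (colonIdeal J (monomial b 1)))).X (i + 1)) :
    ((koszulComplex (quot J)).d (i + 2) (i + 1)).hom (wedgeDiv hJ ht htJ (i + 1) x) =
      wedgeDiv hJ ht htJ i
          (((koszulComplex (quot (colonIdeal J (monomial b 1)))).d (i + 1) i).hom x) +
        (-1 : ℤ) ^ (i + 1) • ((koszulMap (mulMap J (monomial b 1))).f (i + 1)).hom x := by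
  induction x using chain_induction with
  | h z m =>
    rw [wedgeDiv_chain, d_succ_chain, d_succ_chain, koszulD_wedge_succ, variableForm_single,
      one_mul, wedgeDiv_chain]
    refine (TensorProduct.add_tmul _ _ _).trans ?_
    congr 1
    rw [← TensorProduct.smul_tmul', TensorProduct.smul_tmul, X_smul_divMap]
    rfl
  | h0 => simp only [map_zero, smul_zero, add_zero]
  | hadd x y hx hy =>
    simp only [map_add, hx, hy, smul_add]
    abel

theorem d_wedgeDiv_iCycles {i : ℕ}
    (y : (koszulComplex (quot (colonIdeal J (monomial b 1)))).cycles i) :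
    ((koszulComplex (quot J)).d (i + 1) i).hom ((-1 : ℤ) ^ i • wedgeDiv hJ ht htJ i
        (((koszulComplex (quot (colonIdeal J (monomial b 1)))).iCycles i).hom y)) =
      ((koszulMap (mulMap J (monomial b 1))).f i).hom
        (((koszulComplex (quot (colonIdeal J (monomial b 1)))).iCycles i).hom y) := by
  rw [map_zsmul]
  cases i with
  | zero => rw [d_wedgeDiv_zero, pow_zero, one_smul]
  | succ i =>
    rw [d_wedgeDiv_succ, d_iCycles, map_zero, zero_add, smul_smul, ← mul_pow, neg_one_mul, neg_neg,
      one_pow, one_smul]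

/-- The image of `(-1)^i z ∧ (f/x_t) e_t` in `K_{i+1}(R/I)` is a cycle if `z` is one, and its class
is mapped to `[z]` by the connecting homomorphism. -/
theorem exists_cycle_connecting_eq {i : ℕ}
    (y : (koszulComplex (quot (colonIdeal J (monomial b 1)))).cycles i) :
    ∃ y' : (koszulComplex (quot (adjoin J (monomial b 1)))).cycles (i + 1),
      ((koszulComplex (quot (adjoin J (monomial b 1)))).iCycles (i + 1)).hom y' =
        ((koszulMap (projMap J (monomial b 1))).f (i + 1)).hom ((-1 : ℤ) ^ i • wedgeDiv hJ ht htJ i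
          (((koszulComplex (quot (colonIdeal J (monomial b 1)))).iCycles i).hom y)) ∧
      (connecting J (monomial b 1) i).hom
          (((koszulComplex (quot (adjoin J (monomial b 1)))).homologyπ (i + 1)).hom y') =
        ((koszulComplex (quot (colonIdeal J (monomial b 1)))).homologyπ i).hom y := by
  obtain ⟨y', hy'⟩ := exists_iCycles_eq (quot (adjoin J (monomial b 1)))
    (((koszulMap (projMap J (monomial b 1))).f (i + 1)).hom ((-1 : ℤ) ^ i • wedgeDiv hJ ht htJ i
      (((koszulComplex (quot (colonIdeal J (monomial b 1)))).iCycles i).hom y))) (fun j => by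
      -- Only the differential into degree `i` can be nonzero; it gives `f z`, which dies over
      -- `R/I`.
      by_cases hj : i = j
      · subst hj
        rw [koszulMap_d, d_wedgeDiv_iCycles]
        exact (koszulMap_exact J (monomial b 1) i).apply_apply_eq_zero _
      · rw [(koszulComplex _).shape _ _ (fun h => hj (Nat.succ_injective h.symm))]
        rfl)
  exact ⟨y', hy', connecting_homologyπ _ _ y' y _ hy'.symm (d_wedgeDiv_iCycles hJ ht htJ y).symm⟩

end WedgeDiv

/-! ### Multidegrees: coordinates of Koszul chains and homogeneity of the maps -/

section Homogeneous
variable {K : Type u} [Field K] {n : ℕ}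

theorem chain_smul_right (M : ModuleCat.{u} (MvPolynomial (Fin n) K)) {i : ℕ}
    (z : ⋀[MvPolynomial (Fin n) K]^i (FreeMod K n)) (r : MvPolynomial (Fin n) K) (m : M) :
    chain M z (r • m) = chain M (r • z) m :=
  (TensorProduct.smul_tmul _ _ _).symm

theorem chain_zsmul_left (M : ModuleCat.{u} (MvPolynomial (Fin n) K)) {i : ℕ}
    (z : ⋀[MvPolynomial (Fin n) K]^i (FreeMod K n)) (r : ℤ) (m : M) :
    chain M (r • z) m = r • chain M z m :=
  (TensorProduct.smul_tmul' _ _ _).symm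

theorem chain_sum_left (M : ModuleCat.{u} (MvPolynomial (Fin n) K)) {i : ℕ} {ι : Type*}
    (S : Finset ι) (z : ι → ⋀[MvPolynomial (Fin n) K]^i (FreeMod K n)) (m : M) :
    chain M (∑ s ∈ S, z s) m = ∑ s ∈ S, chain M (z s) m :=
  TensorProduct.sum_tmul _ _ _

theorem chain_add_right (M : ModuleCat.{u} (MvPolynomial (Fin n) K)) {i : ℕ}
    (z : ⋀[MvPolynomial (Fin n) K]^i (FreeMod K n)) (m m' : M) :
    chain M z (m + m') = chain M z m + chain M z m' :=
  TensorProduct.tmul_add _ _ _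

theorem chain_zero_right (M : ModuleCat.{u} (MvPolynomial (Fin n) K)) {i : ℕ}
    (z : ⋀[MvPolynomial (Fin n) K]^i (FreeMod K n)) : chain M z 0 = 0 :=
  TensorProduct.tmul_zero _ _

/-- `e_{v_1} ∧ ⋯ ∧ e_{v_i}`. -/
noncomputable abbrev basisWedge (K : Type u) [Field K] {n i : ℕ} (v : Fin i → Fin n) :
    ⋀[MvPolynomial (Fin n) K]^i (FreeMod K n) :=
  exteriorPower.ιMulti (MvPolynomial (Fin n) K) i (fun k => (Pi.single (v k) 1 : FreeMod K n))

/-- The coefficient in `M` of the basis vector `e_{s_1} ∧ ⋯ ∧ e_{s_i}`, `s_1 < ⋯ < s_i`. -/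
noncomputable def coordMap (M : ModuleCat.{u} (MvPolynomial (Fin n) K)) {i : ℕ}
    (s : Set.powersetCard (Fin n) i) :
    (koszulComplex M).X i →ₗ[MvPolynomial (Fin n) K] M :=
  (TensorProduct.lid (MvPolynomial (Fin n) K) M).toLinearMap ∘ₗ
    (exteriorPower.ιMultiDual (MvPolynomial (Fin n) K) i
      (Pi.basisFun (MvPolynomial (Fin n) K) (Fin n)) s).rTensor M

theorem coordMap_chain (M : ModuleCat.{u} (MvPolynomial (Fin n) K)) {i : ℕ}
    (s : Set.powersetCard (Fin n) i) (z : ⋀[MvPolynomial (Fin n) K]^i (FreeMod K n)) (m : M) :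
    coordMap M s (chain M z m) = exteriorPower.ιMultiDual (MvPolynomial (Fin n) K) i
      (Pi.basisFun (MvPolynomial (Fin n) K) (Fin n)) s z • m := rfl

theorem coordMap_koszulMap {M N : ModuleCat.{u} (MvPolynomial (Fin n) K)} (φ : M ⟶ N) {i : ℕ}
    (s : Set.powersetCard (Fin n) i) (x : (koszulComplex M).X i) :
    coordMap N s (((koszulMap φ).f i).hom x) = φ.hom (coordMap M s x) := by
  induction x using chain_induction with
  | h z m =>
    rw [coordMap_chain, map_smul]
    rfl
  | h0 => simp only [map_zero]
  | hadd x y hx hy => simp only [map_add, hx, hy]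

theorem sum_chain_coordMap (M : ModuleCat.{u} (MvPolynomial (Fin n) K)) {i : ℕ}
    (x : (koszulComplex M).X i) :
    ∑ s, chain M (basisWedge K (Set.powersetCard.ofFinEmbEquiv.symm s)) (coordMap M s x) = x := by
  induction x using chain_induction with
  | h z m =>
    simp only [coordMap_chain, chain_smul_right]
    rw [← chain_sum_left]
    congr 1
    have h := ((Pi.basisFun (MvPolynomial (Fin n) K) (Fin n)).exteriorPower i).sum_repr z
    simp only [exteriorPower.basis_repr_apply, exteriorPower.basis_apply] at h
    conv_rhs => rw [← h]
    refine Finset.sum_congr rfl fun s _ => ?_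
    congr 1
    refine congrArg (exteriorPower.ιMulti (MvPolynomial (Fin n) K) i) (funext fun k => ?_)
    exact (Pi.basisFun_apply _ _ _).symm
  | h0 =>
    simp only [map_zero, chain_zero_right, Finset.sum_const_zero]
  | hadd x y hx hy =>
    conv_rhs => rw [← hx, ← hy]
    simp only [map_add, chain_add_right, Finset.sum_add_distrib]

theorem ιMultiDual_basisWedge {i : ℕ} (s : Set.powersetCard (Fin n) i) (v : Fin i → Fin n) :
    ∃ d : ℤ, exteriorPower.ιMultiDual (MvPolynomial (Fin n) K) i
        (Pi.basisFun (MvPolynomial (Fin n) K) (Fin n)) s (basisWedge K v) = d ∧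
      (d ≠ 0 → ∑ k, Pi.single (v k) (1 : ℤ) =
        ∑ k, (Pi.single (Set.powersetCard.ofFinEmbEquiv.symm s k) 1 : Fin n → ℤ)) := by
  -- The coordinate is the determinant of this 0-1 matrix. If it is nonzero, some permutation
  -- matches `v` with `s`, so the two degrees agree. Taking it over `ℤ` matters: components are only
  -- additive subgroups.
  let A : Matrix (Fin i) (Fin i) ℤ := Matrix.of fun k l =>
    if Set.powersetCard.ofFinEmbEquiv.symm s l = v k then 1 else 0
  refine ⟨A.det, ?_, fun h => ?_⟩
  · rw [exteriorPower.ιMultiDual_apply_ιMulti, Int.cast_det]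
    congr 1
    ext1 k l
    simp [A, Matrix.map_apply, Pi.single_apply]
  · rw [Matrix.det_apply] at h
    obtain ⟨σ, -, hσ⟩ := Finset.exists_ne_zero_of_sum_ne_zero h
    have hσ' : ∏ l, A (σ l) l ≠ 0 := fun h0 => hσ (by rw [h0, smul_zero])
    rw [← Equiv.sum_comp σ]
    refine Finset.sum_congr rfl fun l _ => ?_
    have := Finset.prod_ne_zero_iff.mp hσ' l (Finset.mem_univ l)
    rw [(ite_ne_right_iff.mp this).1]

/-- The generators allow unordered and repeated indices; in the basis of increasing wedges each
contributes integer multiples of `m`, and only at the wedge of the same degree. -/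
theorem mem_koszulComponent_iff (M : ModuleCat.{u} (MvPolynomial (Fin n) K))
    (𝒜 : (Fin n → ℤ) → AddSubgroup M) {i : ℕ} (a : Fin n → ℤ) (x : (koszulComplex M).X i) :
    x ∈ koszulComponent M 𝒜 i a ↔ ∀ s : Set.powersetCard (Fin n) i, coordMap M s x ∈
      𝒜 (a - ∑ k, Pi.single (Set.powersetCard.ofFinEmbEquiv.symm s k) 1) := by
  constructor
  · intro hx s
    induction hx using AddSubgroup.closure_induction with
    | mem x hx =>
      obtain ⟨v, m, hm, rfl⟩ := hx
      obtain ⟨d, hd, hdv⟩ := ιMultiDual_basisWedge (K := K) s v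
      rw [coordMap_chain, hd, Int.cast_smul_eq_zsmul]
      by_cases h : d = 0
      · rw [h, zero_smul]
        exact zero_mem _
      · rw [← hdv h]
        exact zsmul_mem hm d
    | zero =>
      rw [map_zero]
      exact zero_mem _
    | add x y _ _ hx hy =>
      rw [map_add]
      exact add_mem hx hy
    | neg x _ hx =>
      rw [map_neg]
      exact neg_mem hx
  · intro h
    rw [← sum_chain_coordMap M x]
    exact sum_mem fun s _ => AddSubgroup.subset_closure ⟨_, _, h s, rfl⟩

theorem koszulMap_mem_koszulComponent {M N : ModuleCat.{u} (MvPolynomial (Fin n) K)} (φ : M ⟶ N)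
    {𝒜 : (Fin n → ℤ) → AddSubgroup M} {ℬ : (Fin n → ℤ) → AddSubgroup N}
    (hφ : ∀ a, ∀ m ∈ 𝒜 a, φ.hom m ∈ ℬ a) {i : ℕ} {a : Fin n → ℤ}
    {x : (koszulComplex M).X i} (hx : x ∈ koszulComponent M 𝒜 i a) :
    ((koszulMap φ).f i).hom x ∈ koszulComponent N ℬ i a := by
  rw [mem_koszulComponent_iff] at hx ⊢
  intro s
  rw [coordMap_koszulMap]
  exact hφ _ _ (hx s)

theorem exists_mem_koszulComponent {M N : ModuleCat.{u} (MvPolynomial (Fin n) K)} (φ : M ⟶ N)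
    {𝒜 : (Fin n → ℤ) → AddSubgroup M} {ℬ : (Fin n → ℤ) → AddSubgroup N}
    (hφ : ∀ a, ∀ m ∈ ℬ a, ∃ m' ∈ 𝒜 a, φ.hom m' = m) {i : ℕ} {a : Fin n → ℤ}
    {x : (koszulComplex N).X i} (hx : x ∈ koszulComponent N ℬ i a) :
    ∃ x' ∈ koszulComponent M 𝒜 i a, ((koszulMap φ).f i).hom x' = x := by
  rw [mem_koszulComponent_iff] at hx
  choose m hm hmx using fun s => hφ _ _ (hx s)
  refine ⟨∑ s, chain M (basisWedge K (Set.powersetCard.ofFinEmbEquiv.symm s)) (m s),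
    sum_mem fun s _ => AddSubgroup.subset_closure ⟨_, _, hm s, rfl⟩, ?_⟩
  rw [map_sum, ← sum_chain_coordMap N x]
  refine Finset.sum_congr rfl fun s _ => ?_
  rw [← hmx s]
  rfl

theorem koszulD_basisWedge {i : ℕ} (v : Fin (i + 1) → Fin n) :
    koszulD K n i (basisWedge K v) = ∑ k : Fin (i + 1), (-1 : ℤ) ^ (k : ℕ) •
      (X (v k) : MvPolynomial (Fin n) K) • basisWedge K (fun l => v (k.succAbove l)) := by
  apply Subtype.ext
  refine (contraction_ιMulti i _).trans ?_
  rw [Submodule.coe_sum]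
  refine Finset.sum_congr rfl fun k _ => ?_
  rw [variableForm_single, one_mul]
  rfl

/-- Each term of the differential drops `e_{v_k}` and gains `x_{v_k}`, which have the same
multidegree. -/
theorem d_mem_koszulComponent (M : ModuleCat.{u} (MvPolynomial (Fin n) K))
    (𝒜 : (Fin n → ℤ) → AddSubgroup M)
    (hX : ∀ a j, ∀ m ∈ 𝒜 a, (X j : MvPolynomial (Fin n) K) • m ∈ 𝒜 (a + Pi.single j 1))
    {i : ℕ} {a : Fin n → ℤ} {x : (koszulComplex M).X (i + 1)}
    (hx : x ∈ koszulComponent M 𝒜 (i + 1) a) :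
    ((koszulComplex M).d (i + 1) i).hom x ∈ koszulComponent M 𝒜 i a := by
  induction hx using AddSubgroup.closure_induction with
  | mem x hx =>
    obtain ⟨v, m, hm, rfl⟩ := hx
    rw [d_succ_chain, koszulD_basisWedge, chain_sum_left]
    refine sum_mem fun k _ => ?_
    rw [chain_zsmul_left, ← chain_smul_right]
    have h : a - ∑ l, Pi.single (v (k.succAbove l)) 1 =
        a - ∑ l, Pi.single (v l) (1 : ℤ) + Pi.single (v k) 1 := by
      rw [Fin.sum_univ_succAbove _ k]
      abel
    have hk : chain M (basisWedge K (fun l => v (k.succAbove l)))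
        ((X (v k) : MvPolynomial (Fin n) K) • m) ∈ koszulComponent M 𝒜 i a :=
      AddSubgroup.subset_closure ⟨fun l => v (k.succAbove l), _, h ▸ hX _ (v k) m hm, rfl⟩
    exact zsmul_mem hk _
  | zero =>
    rw [map_zero]
    exact zero_mem _
  | add x y _ _ hx hy =>
    rw [map_add]
    exact add_mem hx hy
  | neg x _ hx =>
    rw [map_neg]
    exact neg_mem hx

theorem projMap_mem_quotComponent (J : Ideal (MvPolynomial (Fin n) K))
    (f : MvPolynomial (Fin n) K) (a : Fin n → ℤ) (m : quot J) (hm : m ∈ quotComponent J a) :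
    (projMap J f).hom m ∈ quotComponent (adjoin J f) a := by
  obtain ⟨p, hp, rfl⟩ := hm
  exact ⟨p, hp, rfl⟩

theorem exists_projMap_eq_of_mem_quotComponent (J : Ideal (MvPolynomial (Fin n) K))
    (f : MvPolynomial (Fin n) K) (a : Fin n → ℤ) (m : quot (adjoin J f))
    (hm : m ∈ quotComponent (adjoin J f) a) :
    ∃ m' ∈ quotComponent J a, (projMap J f).hom m' = m := by
  obtain ⟨p, hp, rfl⟩ := hm
  exact ⟨_, ⟨p, hp, rfl⟩, rfl⟩

theorem homologyProj_mem_homologyComponent (J : Ideal (MvPolynomial (Fin n) K))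
    (f : MvPolynomial (Fin n) K) (i : ℕ) (a : Fin n → ℤ) (h : koszulHomology (quot J) i)
    (hh : h ∈ homologyComponent (quot J) (quotComponent J) i a) :
    (homologyProj J f i).hom h ∈
      homologyComponent (quot (adjoin J f)) (quotComponent (adjoin J f)) i a := by
  obtain ⟨y, hy, rfl⟩ := hh
  obtain ⟨y', hy', h'⟩ := homologyMap_homologyπ (projMap J f) y
  refine ⟨y', ?_, h'.symm⟩
  change ((koszulComplex (quot (adjoin J f))).iCycles i).hom y' ∈
    koszulComponent (quot (adjoin J f)) (quotComponent (adjoin J f)) i a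
  rw [hy']
  exact koszulMap_mem_koszulComponent _ (projMap_mem_quotComponent J f) hy

theorem connecting_mem_homologyComponent {J : Ideal (MvPolynomial (Fin n) K)}
    (hJ : IsMonomialIdeal J) (b : Fin n →₀ ℕ) (i : ℕ) (a : Fin n → ℤ)
    (h : koszulHomology (quot (adjoin J (monomial b 1))) (i + 1))
    (hh : h ∈ homologyComponent (quot (adjoin J (monomial b 1)))
      (quotComponent (adjoin J (monomial b 1))) (i + 1) a) :
    (connecting J (monomial b 1) i).hom h ∈
      homologyComponent (quot (colonIdeal J (monomial b 1)))
        (shiftGrading (fun j => (b j : ℤ)) (quotComponent (colonIdeal J (monomial b 1)))) i a := by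
  obtain ⟨y, hy, rfl⟩ := hh
  -- The lift must be homogeneous of degree `a`, so that `∂x = f w` is too.
  obtain ⟨x, hx, hxy⟩ := exists_mem_koszulComponent (projMap J (monomial b 1))
    (exists_projMap_eq_of_mem_quotComponent J (monomial b 1)) hy
  obtain ⟨w, hw⟩ := (koszulMap_exact J (monomial b 1) i
    (((koszulComplex (quot J)).d (i + 1) i).hom x)).mp (by
      rw [← koszulMap_d, hxy]
      exact d_iCycles _ _ _ y)
  obtain ⟨y', rfl⟩ := exists_iCycles_eq (quot (colonIdeal J (monomial b 1))) w
    ((koszulSequence_shortExact J (monomial b 1)).d_eq_zero_of_f_eq_d_apply (i + 1) i x w hw)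
  refine ⟨y', ?_, (connecting_homologyπ J _ y y' x hxy hw).symm⟩
  refine (mem_koszulComponent_iff _ _ _ _).mpr fun s => ?_
  -- Division by `f` lowers the degree of each coordinate by `b`, which is the shift by definition.
  refine mem_quotComponent_of_mulMap_mem hJ b _ _ ?_
  have hd := d_mem_koszulComponent _ _ (smul_X_mem_quotComponent J) hx
  rw [← hw, mem_koszulComponent_iff] at hd
  rw [← coordMap_koszulMap]
  exact hd s

end Homogeneous
end KoszulMonomial

/-! ### The short exact sequence and the explicit preimages -/

theorem theorem2p5 {K : Type u} [Field K] {n : ℕ}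
    (J : Ideal (MvPolynomial (Fin n) K)) (hJ : IsMonomialIdeal J)
    (b : Fin n →₀ ℕ) (f : MvPolynomial (Fin n) K) (hf : f = monomial b 1) (hfJ : f ∉ J)
    (t : Fin n) (ht : b t ≠ 0) (htJ : ∀ a ∈ minimalGeneratorExponents J, a t = 0) (i : ℕ) :
    -- the sequence `0 → H_{i+1}(R/J) → H_{i+1}(R/I) → H_i(R/(J:I)(-b)) → 0` is exact
    Function.Injective (homologyProj J f (i + 1)).hom ∧
    Function.Exact (homologyProj J f (i + 1)).hom (connecting J f i).hom ∧
    Function.Surjective (connecting J f i).hom ∧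
    -- its maps are homogeneous of degree `0`
    (∀ a : Fin n → ℤ, ∀ h ∈ homologyComponent (quot J) (quotComponent J) (i + 1) a,
      (homologyProj J f (i + 1)).hom h ∈
        homologyComponent (quot (adjoin J f)) (quotComponent (adjoin J f)) (i + 1) a) ∧
    (∀ a : Fin n → ℤ, ∀ h ∈ homologyComponent (quot (adjoin J f))
        (quotComponent (adjoin J f)) (i + 1) a,
      (connecting J f i).hom h ∈
        homologyComponent (quot (colonIdeal J f))
          (shiftGrading (fun j => (b j : ℤ)) (quotComponent (colonIdeal J f))) i a) ∧
    -- the chain `(-1)^i z ∧ (f/x_t) e_t` over `R/I` depends only on the chain `z` over `R/(J:I)`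
    (∀ z z' : ⋀[MvPolynomial (Fin n) K]^i (FreeMod K n),
      chain (quot (colonIdeal J f)) z 1 = chain (quot (colonIdeal J f)) z' 1 →
      chain (quot (adjoin J f))
        ((-1 : ℤ) ^ i • wedge z (Pi.single t (monomial (b - Finsupp.single t 1) 1))) 1 =
      chain (quot (adjoin J f))
        ((-1 : ℤ) ^ i • wedge z' (Pi.single t (monomial (b - Finsupp.single t 1) 1))) 1) ∧
    -- it is a cycle if `z` is one, and its class is then a preimage of `[z]` under `δ`
    (∀ (z : ⋀[MvPolynomial (Fin n) K]^i (FreeMod K n))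
      (c : koszulHomology (quot (colonIdeal J f)) i),
      IsClassOf (chain (quot (colonIdeal J f)) z 1) c →
      ∃ c' : koszulHomology (quot (adjoin J f)) (i + 1),
        IsClassOf (chain (quot (adjoin J f))
          ((-1 : ℤ) ^ i • wedge z (Pi.single t (monomial (b - Finsupp.single t 1) 1))) 1) c' ∧
        (connecting J f i).hom c' = c) := by
  subst hf
  have key := fun {i : ℕ} => exists_cycle_connecting_eq hJ ht htJ (i := i)
  have hsurj : ∀ i, Function.Surjective (connecting J (monomial b 1) i).hom := by
    intro i c
    obtain ⟨y, rfl⟩ := homologyπ_surjective _ _ c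
    obtain ⟨y', -, hy'⟩ := key y
    exact ⟨_, hy'⟩
  -- Injectivity on `H_{i+1}` uses `δ` one degree higher, from `H_{i+2}` to `H_{i+1}`; hence
  -- surjectivity was proved for all degrees.
  refine ⟨homologyProj_injective_of_connecting_surjective J _ _ (hsurj (i + 1)),
    homologyProj_connecting_exact J _ i, hsurj i,
    homologyProj_mem_homologyComponent J _ (i + 1),
    connecting_mem_homologyComponent hJ b i, ?_, ?_⟩
  · intro z z' h
    rw [← koszulMap_projMap_wedgeDiv hJ ht htJ, h, koszulMap_projMap_wedgeDiv]
  · rintro z c ⟨y, hy, rfl⟩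
    obtain ⟨y', hy', h⟩ := key y
    refine ⟨_, ⟨y', ?_, rfl⟩, h⟩
    rw [hy', hy, koszulMap_projMap_wedgeDiv]
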